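/- A quantum random access code (QRAC) with shared randomness that encodes $N\ge 1$ bits into a $d$-dimensional quantum state consists of a shared random variable $\lambda$ (on any probability space) and, for each value of $\lambda$ and depending measurably on it, of a $d\times d$ density matrix $\rho^\lambda_x$ for each $x\in\{0,1\}^N$ and a two-outcome measurement $(E^\lambda_{i,0},E^\lambda_{i,1})$ for each $i\in\{1,\dots,N\}$ (positive semidefinite $d\times d$ matrices with $E^\lambda_{i,0}+E^\lambda_{i,1}=I$). Its average bias is $$\epsilon=\mathbb{E}_\lambda\,\frac{1}{2^N N}\sum_{x\in\{0,1\}^N}\sum_{i=1}^N \operatorname{Tr}\bigl(\rho^\lambda_x E^\lambda_{i,x_i}\bigr)-\frac12 ,$$ that is, the winning probability, averaged over uniformly random $x$ and $i$, minus $\tfrac12$. **Lemma.** (1) There is an absolute constant $C$ such that for all $N\ge1$ and $d$, every QRAC with shared randomness that encodes $N$ bits into a $d$-dimensional state has average bias satisfying $|\epsilon|\le C\sqrt{\frac{\log d}{N}}$. (2) In particular, for every polynomial $p$ with natural-number coefficients there is a polynomial $q$ with natural-number coefficients such that for all $n\ge 0$ and $d\le 2^{p(n)}$, every QRAC with shared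 randomness that encodes $N=2^n$ bits into a $d$-dimensional state has average bias satisfying $|\epsilon|\le 2^{-n/2}\,q(n)$. -/

import Mathlib

open MeasureTheory
open scoped ComplexOrder

/-- A state of a `d`-dimensional quantum system: a positive semidefinite `d × d` complex matrix
of trace one. -/
structure IsDensityMatrix {d : ℕ} (ρ : Matrix (Fin d) (Fin d) ℂ) : Prop where
  posSemidef : ρ.PosSemidef
  trace_eq_one : ρ.trace = 1

/-- A quantum measurement of a `d`-dimensional system with outcome in `{0, 1}` (a two-outcome
POVM): `E b` is the effect of the outcome `b`. The associated observable is `E false - E true`;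
the Hermitian matrices of operator norm at most one are exactly the observables obtained so. -/
structure IsBitMeasurement {d : ℕ} (E : Bool → Matrix (Fin d) (Fin d) ℂ) : Prop where
  posSemidef : ∀ b, (E b).PosSemidef
  sum_eq_one : ∑ b, E b = 1

/-- A quantum random access code encoding `N` bits into a `d`-dimensional state, where encoder
and decoder share a random variable with values in `Λ`. For the value `l` of the shared random
variable, the string `x` is encoded as the state `state l x`, and the `i`-th bit is recovered with
the measurement `effect l i`. -/
structure QRAC (N d : ℕ) (Λ : Type*) [MeasurableSpace Λ] where
  state : Λ → (Fin N → Bool) → Matrix (Fin d) (Fin d) ℂ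
  effect : Λ → Fin N → Bool → Matrix (Fin d) (Fin d) ℂ
  isDensityMatrix_state : ∀ l x, IsDensityMatrix (state l x)
  isBitMeasurement_effect : ∀ l i, IsBitMeasurement (effect l i)
  measurable_state : ∀ x j k, Measurable fun l => state l x j k
  measurable_effect : ∀ i b j k, Measurable fun l => effect l i b j k

namespace QRAC

variable {N d : ℕ} {Λ : Type*} [MeasurableSpace Λ]

/-- The probability (Born rule) that the decoder, asked for the `i`-th bit of `x`, outputs the
correct value `x i`, when the shared random variable has the value `l`. -/
noncomputable def successProb (c : QRAC N d Λ) (l : Λ) (x : Fin N → Bool) (i : Fin N) : ℝ :=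
  (c.state l x * c.effect l i (x i)).trace.re

/-- The winning probability, for a shared random variable of law `μ`, averaged over uniformly
random `x ∈ {0, 1} ^ N` and uniformly random `i ∈ {1, …, N}`. -/
noncomputable def winProb (c : QRAC N d Λ) (μ : Measure Λ) : ℝ :=
  ∫ l, (∑ x : Fin N → Bool, ∑ i : Fin N, c.successProb l x i) / (2 ^ N * N) ∂μ

/-- The average bias. -/
noncomputable def averageBias (c : QRAC N d Λ) (μ : Measure Λ) : ℝ :=
  c.winProb μ - 1 / 2

end QRAC

/-! Fix the shared randomness; a bound uniform in it survives averaging. With observables `A i = E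
false - E true`, the bias is `t / (2 * N)`, where `t` is the average over `x` of `Tr (ρ_x S_x)` and
`S_x` is the signed sum of the contractions `A i`. Jensen and the Gibbs bound (`exp_trace_mul_le`)
give `exp (θ t) ≤ 𝔼_x Tr exp (θ S_x)`. Expand `S_x ^ m` into words: every word has norm at most one
and its signs have nonnegative mean, so the moments are at most `d` times those of a scalar
Rademacher sum (`sum_exp_eigenvalues_le`). Hence `exp (θ t) ≤ d (cosh θ) ^ N ≤ d exp (N θ² / 2)`,
and optimising `θ` gives `t² ≤ 2 N log d`. -/

open Matrix

/-! ### Moments of Rademacher sums -/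

section NoncommutativeRademacher

/-- The sign attached to a bit. -/
def bitSign (b : Bool) : ℝ := if b then -1 else 1

/-- Sums of a monomial in independent random signs are nonnegative. -/
lemma sum_prod_bitSign_pow_nonneg {N : ℕ} (e : Fin N → ℕ) :
    0 ≤ ∑ x : Fin N → Bool, ∏ i, bitSign (x i) ^ e i := by
  have h := Finset.prod_univ_sum (fun _ : Fin N => (Finset.univ : Finset Bool))
    (fun i b => bitSign b ^ e i)
  rw [Fintype.piFinset_univ] at h
  rw [← h]
  refine Finset.prod_nonneg fun i _ => ?_
  rcases neg_one_pow_eq_or ℝ (e i) with h | h <;> simp [bitSign, h]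

lemma prod_bitSign_pow_add_single {N : ℕ} (e : Fin N → ℕ) (x : Fin N → Bool) (i : Fin N) :
    ∏ j, bitSign (x j) ^ (e + Pi.single i 1 : Fin N → ℕ) j =
      (∏ j, bitSign (x j) ^ e j) * bitSign (x i) := by
  simp only [Pi.add_apply, pow_add, Finset.prod_mul_distrib]
  congr 1
  rw [Finset.prod_eq_single i] <;> simp +contextual

/-- Moments of a Rademacher sum of contractions are dominated by those of the scalar Rademacher
sum, also after multiplication with a monomial in the signs. -/
lemma norm_sum_monomial_smul_pow_le {R : Type*} [NormedRing R] [NormedAlgebra ℝ R]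
    (h1 : ‖(1 : R)‖ ≤ 1) {N : ℕ} (A : Fin N → R) (hA : ∀ i, ‖A i‖ ≤ 1) (m : ℕ)
    (e : Fin N → ℕ) :
    ‖∑ x : Fin N → Bool, (∏ i, bitSign (x i) ^ e i) • (∑ i, bitSign (x i) • A i) ^ m‖ ≤
      ∑ x : Fin N → Bool, (∏ i, bitSign (x i) ^ e i) * (∑ i, bitSign (x i)) ^ m := by
  -- Peeling one factor off the power multiplies the monomial by a sign, so the exponents `e` must
  -- vary.
  induction m generalizing e with
  | zero =>
    simp only [pow_zero, mul_one, ← Finset.sum_smul]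
    rw [norm_smul, Real.norm_of_nonneg (sum_prod_bitSign_pow_nonneg e)]
    exact mul_le_of_le_one_right (sum_prod_bitSign_pow_nonneg e) h1
  | succ m ih =>
    have hl : ∑ x : Fin N → Bool,
        (∏ i, bitSign (x i) ^ e i) • (∑ i, bitSign (x i) • A i) ^ (m + 1) =
        ∑ i, A i * ∑ x : Fin N → Bool, (∏ j, bitSign (x j) ^ (e + Pi.single i 1 : Fin N → ℕ) j) •
          (∑ i, bitSign (x i) • A i) ^ m := by
      simp_rw [Finset.mul_sum]
      rw [Finset.sum_comm]
      refine Finset.sum_congr rfl fun x _ => ?_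
      rw [pow_succ', Finset.sum_mul, Finset.smul_sum]
      refine Finset.sum_congr rfl fun i _ => ?_
      rw [prod_bitSign_pow_add_single, smul_mul_assoc, smul_smul, mul_smul_comm]
    have hr : ∑ x : Fin N → Bool,
        (∏ i, bitSign (x i) ^ e i) * (∑ i, bitSign (x i)) ^ (m + 1) =
        ∑ i, ∑ x : Fin N → Bool, (∏ j, bitSign (x j) ^ (e + Pi.single i 1 : Fin N → ℕ) j) *
          (∑ i, bitSign (x i)) ^ m := by
      rw [Finset.sum_comm]
      refine Finset.sum_congr rfl fun x _ => ?_
      rw [pow_succ', Finset.sum_mul, Finset.mul_sum]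
      refine Finset.sum_congr rfl fun i _ => ?_
      rw [prod_bitSign_pow_add_single, mul_assoc]
    rw [hl, hr]
    refine (norm_sum_le _ _).trans (Finset.sum_le_sum fun i _ => ?_)
    exact (norm_mul_le _ _).trans
      ((mul_le_of_le_one_left (norm_nonneg _) (hA i)).trans (ih _))

lemma sum_exp_mul_sum_bitSign (N : ℕ) (θ : ℝ) :
    ∑ x : Fin N → Bool, Real.exp (θ * ∑ i, bitSign (x i)) = (2 * Real.cosh θ) ^ N := by
  have h := Finset.prod_univ_sum (fun _ : Fin N => (Finset.univ : Finset Bool))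
    (fun _ b => Real.exp (θ * bitSign b))
  rw [Fintype.piFinset_univ] at h
  simp_rw [Finset.mul_sum, Real.exp_sum]
  rw [← h]
  simp [bitSign, Real.cosh_eq]
  ring

end NoncommutativeRademacher

namespace Matrix

/-! ### Traces in an eigenbasis -/

section Spectral

variable {n : Type*} [Fintype n] [DecidableEq n]

lemma IsHermitian.trace_pow_eq_sum {S : Matrix n n ℂ} (hS : S.IsHermitian) (m : ℕ) :
    (S ^ m).trace = ∑ j, (hS.eigenvalues j : ℂ) ^ m := by
  conv_lhs => rw [hS.spectral_theorem, ← map_pow, Unitary.conjStarAlgAut_apply, trace_mul_comm,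
    ← mul_assoc, Unitary.coe_star_mul_self, one_mul, diagonal_pow, trace_diagonal]
  simp

/-- The weights are the diagonal of `ρ` in an eigenbasis of `S`. -/
lemma IsHermitian.exists_trace_mul_eq_sum {S ρ : Matrix n n ℂ} (hS : S.IsHermitian)
    (hρ : ρ.PosSemidef) (hρ1 : ρ.trace = 1) :
    ∃ p : n → ℝ, (∀ j, 0 ≤ p j) ∧ ∑ j, p j = 1 ∧
      (ρ * S).trace.re = ∑ j, p j * hS.eigenvalues j := by
  set U : Matrix n n ℂ := (hS.eigenvectorUnitary : Matrix n n ℂ) with hU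
  have hUU : U * star U = 1 := Unitary.coe_mul_star_self hS.eigenvectorUnitary
  have hτ : (star U * ρ * U).PosSemidef := hρ.conjTranspose_mul_mul_same U
  refine ⟨fun j => ((star U * ρ * U) j j).re, fun j => ?_, ?_, ?_⟩
  · exact (Complex.le_def.1 (hτ.diag_nonneg (i := j))).1
  · rw [← Complex.re_sum]
    change ((star U * ρ * U).trace).re = 1
    rw [trace_mul_comm, ← mul_assoc, hUU, one_mul, hρ1, Complex.one_re]
  · have h : (ρ * S).trace =
        ((star U * ρ * U) * diagonal (RCLike.ofReal ∘ hS.eigenvalues)).trace := by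
      conv_lhs => rw [hS.spectral_theorem, Unitary.conjStarAlgAut_apply, ← hU]
      rw [← mul_assoc, trace_mul_comm]
      simp only [mul_assoc]
    rw [h, trace, Complex.re_sum]
    refine Finset.sum_congr rfl fun j _ => ?_
    simp [mul_diagonal]

/-- The Gibbs variational bound: the expectation of an observable in a state is controlled by its
partition function. -/
lemma IsHermitian.exp_trace_mul_le {S ρ : Matrix n n ℂ} (hS : S.IsHermitian)
    (hρ : ρ.PosSemidef) (hρ1 : ρ.trace = 1) (θ : ℝ) :
    Real.exp (θ * (ρ * S).trace.re) ≤ ∑ j, Real.exp (θ * hS.eigenvalues j) := by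
  obtain ⟨p, hp, hp1, h⟩ := hS.exists_trace_mul_eq_sum hρ hρ1
  have hJ := convexOn_exp.map_sum_le (t := Finset.univ) (w := p)
    (p := fun j => θ * hS.eigenvalues j) (fun j _ => hp j) hp1 (fun _ _ => Set.mem_univ _)
  have hle : ∀ j, p j ≤ 1 := fun j =>
    hp1 ▸ Finset.single_le_sum (fun j _ => hp j) (Finset.mem_univ j)
  calc Real.exp (θ * (ρ * S).trace.re)
      = Real.exp (∑ j, p j • (θ * hS.eigenvalues j)) := by
        rw [h, Finset.mul_sum]
        congr 1
        exact Finset.sum_congr rfl fun j _ => by rw [smul_eq_mul]; ring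
    _ ≤ _ := hJ
    _ ≤ _ := Finset.sum_le_sum fun j _ =>
        mul_le_of_le_one_left (Real.exp_pos _).le (hle j)

end Spectral

/-! ### Trace against operator norm -/

section OperatorNorm

open scoped Matrix.Norms.L2Operator

variable {d : ℕ}

lemma norm_entry_le_l2_opNorm (M : Matrix (Fin d) (Fin d) ℂ) (j : Fin d) : ‖M j j‖ ≤ ‖M‖ := by
  have h := l2_opNorm_mulVec M (EuclideanSpace.single j (1 : ℂ))
  rw [PiLp.norm_single, norm_one, mul_one] at h
  refine le_trans ?_ h
  refine le_trans (le_of_eq ?_) (PiLp.norm_apply_le _ j)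
  simp

lemma norm_trace_le (M : Matrix (Fin d) (Fin d) ℂ) : ‖M.trace‖ ≤ d * ‖M‖ := by
  refine (norm_sum_le _ _).trans ?_
  refine (Finset.sum_le_sum fun j _ => norm_entry_le_l2_opNorm M j).trans ?_
  simp

/-- Only an inequality, because the norm is zero when `d = 0`. -/
lemma l2_opNorm_one_le : ‖(1 : Matrix (Fin d) (Fin d) ℂ)‖ ≤ 1 := by
  rw [← diagonal_one, l2_opNorm_diagonal]
  exact (pi_norm_le_iff_of_nonneg zero_le_one).2 fun _ => by simp

end OperatorNorm

end Matrix

/-! ### Observables and the exponential moment bound -/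

section Observable

open scoped Matrix.Norms.L2Operator MatrixOrder

variable {d : ℕ}

lemma IsBitMeasurement.isHermitian_sub {E : Bool → Matrix (Fin d) (Fin d) ℂ}
    (hE : IsBitMeasurement E) : (E false - E true).IsHermitian :=
  (hE.posSemidef false).isHermitian.sub (hE.posSemidef true).isHermitian

lemma IsBitMeasurement.norm_sub_le_one {E : Bool → Matrix (Fin d) (Fin d) ℂ}
    (hE : IsBitMeasurement E) : ‖E false - E true‖ ≤ 1 := by
  have h1 : E true = 1 - E false := by
    have := hE.sum_eq_one
    rw [Fintype.sum_bool] at this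
    exact eq_sub_of_add_eq this
  have hF := hE.posSemidef false
  have hT := hE.posSemidef true
  have hH := hE.isHermitian_sub
  set A := E false - E true with hA
  have hAA : A * A ≤ 1 := by
    rw [Matrix.le_iff]
    -- The effects commute and sum to one, so both sides equal `4 * E false * E true`; the right
    -- side is visibly positive.
    have e : 1 - A * A = (4 : ℝ) • ((E false)ᴴ * E true * E false +
        (E true)ᴴ * E false * E true) := by
      rw [hF.isHermitian.eq, hT.isHermitian.eq, hA, h1]
      rw [ofNat_smul_eq_nsmul]
      noncomm_ring
    rw [e]
    exact ((hT.conjTranspose_mul_mul_same _).add (hF.conjTranspose_mul_mul_same _)).smul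
      (by norm_num)
  have h0 : 0 ≤ A * A := by
    rw [Matrix.nonneg_iff_posSemidef]
    nth_rw 1 [← hH.eq]
    exact Matrix.posSemidef_conjTranspose_mul_self A
  have h2 : ‖A * A‖ ≤ 1 := (CStarAlgebra.norm_le_one_iff_of_nonneg (A * A) h0).2 hAA
  have h3 := Matrix.l2_opNorm_conjTranspose_mul_self A
  rw [hH.eq] at h3
  rw [h3] at h2
  nlinarith [norm_nonneg A]

lemma isHermitian_sum_bitSign_smul {N : ℕ} {A : Fin N → Matrix (Fin d) (Fin d) ℂ}
    (hA : ∀ i, (A i).IsHermitian) (x : Fin N → Bool) :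
    (∑ i, bitSign (x i) • A i).IsHermitian := by
  unfold Matrix.IsHermitian
  rw [Matrix.conjTranspose_sum]
  exact Finset.sum_congr rfl fun i _ => by
    rw [Matrix.conjTranspose_smul, star_trivial, (hA i).eq]

/-- Exponential moment bound for the spectrum of a Rademacher sum of Hermitian contractions. -/
lemma sum_exp_eigenvalues_le {N : ℕ} {A : Fin N → Matrix (Fin d) (Fin d) ℂ}
    (hH : ∀ i, (A i).IsHermitian) (hA : ∀ i, ‖A i‖ ≤ 1) (θ : ℝ) :
    ∑ x : Fin N → Bool, ∑ j, Real.exp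
      (θ * (isHermitian_sum_bitSign_smul hH x).eigenvalues j) ≤ d * (2 * Real.cosh θ) ^ N := by
  have hexp : ∀ t : ℝ, HasSum (fun m : ℕ => t ^ m / (m.factorial : ℝ)) (Real.exp t) := fun t => by
    rw [Real.exp_eq_exp_ℝ]
    exact NormedSpace.exp_series_hasSum_exp' t |>.congr_fun (fun m => by
      rw [smul_eq_mul, div_eq_inv_mul])
  have hL : HasSum (fun m : ℕ => ∑ x : Fin N → Bool, ∑ j,
      (θ * (isHermitian_sum_bitSign_smul hH x).eigenvalues j) ^ m / (m.factorial : ℝ))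
      (∑ x : Fin N → Bool, ∑ j, Real.exp
        (θ * (isHermitian_sum_bitSign_smul hH x).eigenvalues j)) :=
    hasSum_sum fun x _ => hasSum_sum fun j _ => hexp _
  have hR : HasSum (fun m : ℕ => d * ∑ x : Fin N → Bool,
      (|θ| * ∑ i, bitSign (x i)) ^ m / (m.factorial : ℝ)) (d * (2 * Real.cosh θ) ^ N) := by
    rw [← Real.cosh_abs, ← sum_exp_mul_sum_bitSign]
    exact (hasSum_sum fun x _ => hexp _).mul_left _
  -- The exponential series are compared termwise; `|θ|` on the right covers odd powers of a
  -- negative `θ`.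
  refine hasSum_le (fun m => ?_) hL hR
  have hmom := norm_sum_monomial_smul_pow_le Matrix.l2_opNorm_one_le A hA m 0
  simp only [Pi.zero_apply, pow_zero, Finset.prod_const_one, one_smul, one_mul] at hmom
  have htr : ∑ x : Fin N → Bool, ∑ j, (isHermitian_sum_bitSign_smul hH x).eigenvalues j ^ m =
      (∑ x : Fin N → Bool, (∑ i, bitSign (x i) • A i) ^ m).trace.re := by
    rw [Matrix.trace_sum, Complex.re_sum]
    refine Finset.sum_congr rfl fun x _ => ?_
    rw [(isHermitian_sum_bitSign_smul hH x).trace_pow_eq_sum]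
    norm_cast
  have hb : |∑ x : Fin N → Bool, ∑ j, (isHermitian_sum_bitSign_smul hH x).eigenvalues j ^ m| ≤
      d * ∑ x : Fin N → Bool, (∑ i, bitSign (x i)) ^ m := by
    rw [htr]
    exact (Complex.abs_re_le_norm _).trans ((Matrix.norm_trace_le _).trans
      (mul_le_mul_of_nonneg_left hmom (Nat.cast_nonneg d)))
  simp only [mul_pow, ← Finset.mul_sum, ← Finset.sum_div]
  rw [← mul_div_assoc]
  refine div_le_div_of_nonneg_right ?_ (Nat.cast_nonneg _)
  calc _ ≤ |θ ^ m| * |∑ x : Fin N → Bool, ∑ j,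
        (isHermitian_sum_bitSign_smul hH x).eigenvalues j ^ m| := by
        rw [← abs_mul]; exact le_abs_self _
    _ ≤ |θ ^ m| * (d * ∑ x : Fin N → Bool, (∑ i, bitSign (x i)) ^ m) :=
        mul_le_mul_of_nonneg_left hb (abs_nonneg _)
    _ = _ := by rw [abs_pow]; ring

/-- The average overlap of arbitrary states with a Rademacher sum of Hermitian contractions. -/
lemma sq_average_trace_mul_le {N : ℕ} (hN : 1 ≤ N) {A : Fin N → Matrix (Fin d) (Fin d) ℂ}
    (hH : ∀ i, (A i).IsHermitian) (hA : ∀ i, ‖A i‖ ≤ 1)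
    {ρ : (Fin N → Bool) → Matrix (Fin d) (Fin d) ℂ} (hρ : ∀ x, IsDensityMatrix (ρ x)) :
    ((∑ x, (ρ x * ∑ i, bitSign (x i) • A i).trace.re) / 2 ^ N) ^ 2 ≤ 2 * N * Real.log d := by
  set f : (Fin N → Bool) → ℝ := fun x => (ρ x * ∑ i, bitSign (x i) • A i).trace.re with hf
  set t := (∑ x, f x) / 2 ^ N with ht
  have hN0 : (0 : ℝ) < N := by exact_mod_cast hN
  have hd : d ≠ 0 := by
    rintro rfl
    simpa [Matrix.trace] using (hρ fun _ => false).trace_eq_one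
  have hd0 : (0 : ℝ) < d := by exact_mod_cast Nat.pos_of_ne_zero hd
  have key : ∀ θ : ℝ, θ * t ≤ Real.log d + N * θ ^ 2 / 2 := fun θ => by
    have hJ := convexOn_exp.map_sum_le (t := Finset.univ)
      (w := fun _ : Fin N → Bool => ((2 : ℝ) ^ N)⁻¹)
      (p := fun x => θ * f x) (fun _ _ => by positivity) (by simp)
      (fun _ _ => Set.mem_univ _)
    simp only [smul_eq_mul, ← Finset.mul_sum] at hJ
    have h1 : Real.exp (θ * t) ≤ d * Real.cosh θ ^ N := by
      calc Real.exp (θ * t) = Real.exp (((2 : ℝ) ^ N)⁻¹ * (θ * ∑ x, f x)) := by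
            rw [ht]; congr 1; ring
        _ ≤ ((2 : ℝ) ^ N)⁻¹ * ∑ x, Real.exp (θ * f x) := hJ
        _ ≤ ((2 : ℝ) ^ N)⁻¹ * (d * (2 * Real.cosh θ) ^ N) := by
            refine mul_le_mul_of_nonneg_left ?_ (by positivity)
            exact (Finset.sum_le_sum fun x _ =>
              (isHermitian_sum_bitSign_smul hH x).exp_trace_mul_le (hρ x).posSemidef
                (hρ x).trace_eq_one θ).trans (sum_exp_eigenvalues_le hH hA θ)
        _ = d * Real.cosh θ ^ N := by rw [mul_pow]; field_simp
    have h2 : Real.exp (θ * t) ≤ Real.exp (Real.log d + N * θ ^ 2 / 2) := by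
      rw [Real.exp_add, Real.exp_log hd0, mul_div_assoc, Real.exp_nat_mul]
      exact h1.trans (mul_le_mul_of_nonneg_left
        (pow_le_pow_left₀ (Real.cosh_pos θ).le (Real.cosh_le_exp_half_sq θ) N) hd0.le)
    exact Real.exp_le_exp.1 h2
  -- This `θ` maximises `θ * t - N * θ ^ 2 / 2`.
  have h := key (t / N)
  have e1 : t / N * t = t ^ 2 / N := by ring
  have e2 : (N : ℝ) * (t / N) ^ 2 / 2 = t ^ 2 / N / 2 := by field_simp
  rw [e1, e2] at h
  have h3 : t ^ 2 / N ≤ 2 * Real.log d := by linarith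
  rw [div_le_iff₀ hN0] at h3
  linarith

end Observable

/-! ### From observables to the bias -/

namespace QRAC

variable {N d : ℕ} {Λ : Type*} [MeasurableSpace Λ]

lemma successProb_eq (c : QRAC N d Λ) (l : Λ) (x : Fin N → Bool) (i : Fin N) :
    c.successProb l x i = 1 / 2 + 1 / 2 *
      (c.state l x * (bitSign (x i) • (c.effect l i false - c.effect l i true))).trace.re := by
  have hs := (c.isBitMeasurement_effect l i).sum_eq_one
  rw [Fintype.sum_bool] at hs
  have ht : (c.state l x * c.effect l i true).trace.re +
      (c.state l x * c.effect l i false).trace.re = 1 := by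
    rw [← Complex.add_re, ← Matrix.trace_add, ← mul_add, hs, mul_one,
      (c.isDensityMatrix_state l x).trace_eq_one, Complex.one_re]
  unfold successProb
  rw [mul_smul_comm, Matrix.trace_smul, Complex.smul_re, mul_sub, Matrix.trace_sub,
    Complex.sub_re]
  cases x i <;> simp only [bitSign, smul_eq_mul] <;> norm_num <;> linarith

lemma measurable_successProb (c : QRAC N d Λ) (x : Fin N → Bool) (i : Fin N) :
    Measurable fun l => c.successProb l x i := by
  unfold successProb
  simp only [Matrix.trace, Matrix.diag_apply, Matrix.mul_apply]
  refine Complex.measurable_re.comp ?_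
  exact Finset.measurable_fun_sum _ fun j _ => Finset.measurable_fun_sum _ fun k _ =>
    (c.measurable_state x j k).mul (c.measurable_effect i (x i) k j)

/-- The bias for a fixed value of the shared random variable. -/
lemma abs_average_successProb_sub_half_le (hN : 1 ≤ N) (c : QRAC N d Λ) (l : Λ) :
    |(∑ x : Fin N → Bool, ∑ i : Fin N, c.successProb l x i) / (2 ^ N * N) - 1 / 2| ≤
      Real.sqrt (Real.log d / N) := by
  have hN0 : (0 : ℝ) < N := by exact_mod_cast hN
  have hlog : 0 ≤ Real.log d := Real.log_natCast_nonneg d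
  set t := (∑ x, (c.state l x * ∑ i, bitSign (x i) •
    (c.effect l i false - c.effect l i true)).trace.re) / 2 ^ N with ht
  have h : t ^ 2 ≤ 2 * N * Real.log d := sq_average_trace_mul_le hN
    (fun i => (c.isBitMeasurement_effect l i).isHermitian_sub)
    (fun i => (c.isBitMeasurement_effect l i).norm_sub_le_one)
    (c.isDensityMatrix_state l)
  have hsum : (∑ x : Fin N → Bool, ∑ i : Fin N, c.successProb l x i) / (2 ^ N * N) - 1 / 2 =
      t / (2 * N) := by
    simp only [successProb_eq, Finset.sum_add_distrib, ← Finset.mul_sum, ← Complex.re_sum,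
      ← Matrix.trace_sum, ht]
    simp
    field_simp
    ring
  rw [hsum]
  refine Real.abs_le_sqrt ?_
  rw [div_pow, div_le_div_iff₀ (by positivity) hN0]
  nlinarith [mul_le_mul_of_nonneg_right h hN0.le, mul_nonneg (mul_nonneg hN0.le hN0.le) hlog]

lemma abs_averageBias_le (hN : 1 ≤ N) (c : QRAC N d Λ) (μ : Measure Λ) [IsProbabilityMeasure μ] :
    |c.averageBias μ| ≤ Real.sqrt (Real.log d / N) := by
  set f : Λ → ℝ := fun l => (∑ x : Fin N → Bool, ∑ i : Fin N, c.successProb l x i) / (2 ^ N * N)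
    with hf
  have hfm : Measurable f := (Finset.measurable_fun_sum _ fun x _ =>
    Finset.measurable_fun_sum _ fun i _ => c.measurable_successProb x i).div_const _
  have hb : ∀ l, ‖f l - 1 / 2‖ ≤ Real.sqrt (Real.log d / N) := fun l =>
    c.abs_average_successProb_sub_half_le hN l
  have hint : Integrable (fun l => f l - 1 / 2) μ :=
    Integrable.of_bound (hfm.sub_const _).aestronglyMeasurable _ (.of_forall hb)
  have hfi : Integrable f μ := (hint.add (integrable_const (1 / 2 : ℝ))).congr
    (.of_forall fun l => by simp)
  have he : c.averageBias μ = ∫ l, (f l - 1 / 2) ∂μ := by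
    rw [integral_sub hfi (integrable_const _)]
    simp [averageBias, winProb, hf]
  rw [he, ← Real.norm_eq_abs]
  simpa using norm_integral_le_of_norm_le_const (μ := μ) (.of_forall hb)

end QRAC

theorem mainTheorem5 :
    (∃ C : ℝ, ∀ (N d : ℕ), 1 ≤ N →
      ∀ (Λ : Type*) [MeasurableSpace Λ] (μ : Measure Λ) [IsProbabilityMeasure μ]
        (c : QRAC N d Λ),
        |c.averageBias μ| ≤ C * Real.sqrt (Real.log d / N)) ∧
    (∀ p : Polynomial ℕ, ∃ q : Polynomial ℕ, ∀ (n d : ℕ), d ≤ 2 ^ p.eval n →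
      ∀ (Λ : Type*) [MeasurableSpace Λ] (μ : Measure Λ) [IsProbabilityMeasure μ]
        (c : QRAC (2 ^ n) d Λ),
        |c.averageBias μ| ≤ (2 : ℝ) ^ (-(n : ℝ) / 2) * (q.eval n : ℕ)) := by
  -- `C = 1` and `q = p` suffice: `log d ≤ p(n)`, and a natural number is at most its square.
  refine ⟨⟨1, fun N d hN Λ _ μ _ c => by rw [one_mul]; exact c.abs_averageBias_le hN μ⟩,
    fun p => ⟨p, fun n d hd Λ _ μ _ c => ?_⟩⟩
  refine (c.abs_averageBias_le Nat.one_le_two_pow μ).trans (Real.sqrt_le_iff.2 ⟨by positivity, ?_⟩)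
  have hlog : Real.log d ≤ p.eval n := by
    rcases Nat.eq_zero_or_pos d with rfl | h0
    · simp
    · calc Real.log d ≤ Real.log ((2 : ℝ) ^ p.eval n) :=
            Real.log_le_log (by exact_mod_cast h0) (by exact_mod_cast hd)
        _ = p.eval n * Real.log 2 := Real.log_pow _ _
        _ ≤ p.eval n := mul_le_of_le_one_right (Nat.cast_nonneg _)
            (Real.log_two_lt_d9.le.trans (by norm_num))
  have hsq : ((p.eval n : ℕ) : ℝ) ≤ ((p.eval n : ℕ) : ℝ) ^ 2 := by
    exact_mod_cast Nat.le_self_pow two_ne_zero _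
  have h2 : ((2 : ℝ) ^ (-(n : ℝ) / 2)) ^ 2 = ((2 : ℝ) ^ n)⁻¹ := by
    rw [← Real.rpow_natCast, ← Real.rpow_mul zero_le_two, ← Real.rpow_natCast,
      ← Real.rpow_neg zero_le_two]
    congr 1
    push_cast
    ring
  rw [mul_pow, h2, div_eq_inv_mul]
  push_cast
  exact mul_le_mul_of_nonneg_left (hlog.trans hsq) (by positivity)
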